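/- **Conventions.** Let $\mathbb F_{q^n}\subseteq\mathbb F_{q^m}$ ($n\mid m$) and $\sigma\colon x\mapsto x^{q^s}$. For $v\in\mathbb F_{q^m}^n$ let $\mathrm{rk}(v)=\dim_{\mathbb F_q}\langle v_1,\dots,v_n\rangle_{\mathbb F_q}$, $d(u,v)=\mathrm{rk}(u-v)$ and $B_\tau(w)=\{c:\mathrm{rk}(w-c)\le\tau\}$. Let $\mathcal L_{m,\sigma}$ be the set of maps $\mathbb F_{q^m}\to\mathbb F_{q^m}$ of the form $x\mapsto\sum_i a_i x^{\sigma^i}$, $a_i\in\mathbb F_{q^m}$. For a field $\mathbb F_q\subseteq E\subseteq\mathbb F_{q^m}$ put $\mathcal G_{E,h,\sigma}=\{\sum_{i=0}^{h-1}a_ix^{\sigma^i}: a_i\in E\}$ (so $\mathcal G_{\mathbb F_{q^n},h,\sigma}$ is the generalized Gabidulin code $\mathcal G_{n,h,\sigma}$), and $S^{\sigma^j}=\{f(x)^{\sigma^j}:f\in S\}$. For $\mathcal C\subseteq\mathcal L_{m,\sigma}$, the evaluation code of $\mathcal C$ over $\alpha_1,\dots,\alpha_n$ is $\{(g(\alpha_1),\dots,g(\alpha_n)):g\in\mathcal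 C\}$. A list decoding algorithm for a code $\mathrm C\subseteq\mathbb F_{q^m}^n$ at radius $\tau$ writes down, for each $w\in\mathbb F_{q^m}^n$, a list of all codewords in $\mathrm C\cap B_\tau(w)$; it is a Turing machine whose tape cells hold symbols of $\mathbb F_{q^m}$ (or one of finitely many auxiliary symbols), one step moving the head or writing one cell. A family of codes is efficiently list decodable at given radii if its members have such algorithms whose running times are bounded by one polynomial in the length $n$ of the code. **Theorem.** Let $p$ be a prime, $q$ a power of $p$, $k,t$ positive integers, $q'=p^r$ with $r\ge 0$, $p_i=1+q'+\dots+q'^i$, $n=tp_k$, and $m$ a multiple of $n$. Let $s$ be a positive integer coprime with $n$, and $\sigma\colon x\mapsto x^{q^s}$. Let $\mathcal C\subseteq\mathcal L_{m,\sigma}$ and let $\mathrm C$ be the evaluation code of $\mathcal C$ over an $\mathbb F_q$-basis of $\beta\mathbb F_{q^n}$, for some $\beta\in\mathbb F_{q^m}^*$, with minimum distance $d$. Suppose that 1. $\lfloor\frac{d-1}{2}\rfloor+1\le tq'^k\le d-1$; 2. $(\mathcal G_{E,\,t(p_{k-1}-p_0)+1,\,\sigma})^{\sigma^j}\subseteq\mathcal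 C$ for some integer $0\le j<tq'^k$, where $E=\mathbb F_{q^n}(\beta)$ (so $E=\mathbb F_{q^n}$ if $\beta\in\mathbb F_{q^n}$; and the condition holds whenever $\mathcal C$ contains the corresponding code with coefficients in $\mathbb F_{q^m}$). Then $\mathrm C$ cannot be list decoded efficiently at any radius $\tau\ge tq'^k$. That is: for each such $\mathrm C$ and $\tau$ there is a word $w\in\mathbb F_{q^m}^n\setminus\mathrm C$ with $|\mathrm C\cap B_\tau(w)|\ge\frac{q^n-1}{q^t-1}$; and no family of such codes $\mathrm C$ with unbounded lengths $n$ (all parameters may vary along the family) is efficiently list decodable at any choice of radii $\tau\ge tq'^k$. -/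

import Mathlib

noncomputable section

namespace RankMetric

universe u v w

section Codes

variable (K : Type u) {L : Type v} [Field K] [Field L] [Algebra K L] {n : ℕ}

/-- The rank weight of `v = (v₁, …, vₙ)`: the `K`-dimension of the span of its entries. -/
def rankWeight (v : Fin n → L) : ℕ :=
  Module.finrank K (Submodule.span K (Set.range v))

/-- The rank distance `rk (u - v)`. -/
def rankDist (u v : Fin n → L) : ℕ :=
  rankWeight K (u - v)

/-- The ball `B_τ(w)` of radius `τ` around `w` in the rank metric. -/
def rankBall (w : Fin n → L) (τ : ℕ) : Set (Fin n → L) :=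
  {c | rankDist K w c ≤ τ}

/-- The minimum distance of a rank-metric code. -/
def minDist (C : Set (Fin n → L)) : ℕ :=
  sInf {d | ∃ u ∈ C, ∃ v ∈ C, u ≠ v ∧ d = rankDist K u v}

end Codes

section SigmaPolynomials

variable {K : Type u} {L : Type v} [Field K] [Field L] [Algebra K L]

/-- The endomorphism `x ↦ ∑_{i < h} aᵢ x^{σ^i}` of `L` represented by a `σ`-polynomial. -/
def sigmaPoly (σ : L ≃ₐ[K] L) (h : ℕ) (a : Fin h → L) : L →ₗ[K] L :=
  ∑ i : Fin h, a i • (σ ^ (i : ℕ)).toLinearMap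

/-- All endomorphisms of `L` represented by `σ`-polynomials with coefficients in `L`
(the algebra `𝓛_{m,σ}`, where `m = [L : K]`). -/
def sigmaPolynomials (σ : L ≃ₐ[K] L) : Set (L →ₗ[K] L) :=
  {f | ∃ (h : ℕ) (a : Fin h → L), f = sigmaPoly σ h a}

/-- The generalized Gabidulin code of the `σ`-polynomials `∑_{i < h} aᵢ x^{σ^i}` whose
coefficients lie in the intermediate field `E`. It is `𝓖_{n,h,σ}` for `E = 𝔽_{q^n}` and
`𝓖_{m,h,σ}` for `E = L`. -/
def gabidulin (σ : L ≃ₐ[K] L) (E : IntermediateField K L) (h : ℕ) : Set (L →ₗ[K] L) :=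
  {f | ∃ a : Fin h → L, (∀ i, a i ∈ E) ∧ f = sigmaPoly σ h a}

/-- `S^{σ^j} = {f(x)^{σ^j} : f ∈ S}`. -/
def sigmaTwist (σ : L ≃ₐ[K] L) (j : ℕ) (S : Set (L →ₗ[K] L)) : Set (L →ₗ[K] L) :=
  {g | ∃ f ∈ S, g = (σ ^ j).toLinearMap ∘ₗ f}

/-- The evaluation code `{(g(α₁), …, g(αₙ)) : g ∈ 𝒞}`. -/
def evalCode {n : ℕ} (α : Fin n → L) (𝒞 : Set (L →ₗ[K] L)) : Set (Fin n → L) :=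
  {c | ∃ g ∈ 𝒞, c = fun i => g (α i)}

end SigmaPolynomials

/-- `p_i = 1 + q' + q'^2 + ⋯ + q'^i`. -/
def geomSum (q' i : ℕ) : ℕ :=
  ∑ j ∈ Finset.range (i + 1), q' ^ j

section ListDecoding

/-- A deterministic one-tape Turing machine with finitely many states. A tape cell holds a blank
(`none`), a symbol of the code alphabet `L`, or one of finitely many auxiliary work symbols. One
step moves the head by one cell or writes one cell. -/
structure DecodingMachine (L : Type v) where
  /-- the states; the default state is the initial one -/
  State : Type
  /-- the auxiliary work symbols -/
  Work : Type
  [stateInhabited : Inhabited State]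
  [stateFinite : Finite State]
  [workFinite : Finite Work]
  /-- the transition function -/
  machine : Turing.TM0.Machine (Option (L ⊕ Work)) State

attribute [instance] DecodingMachine.stateInhabited

namespace DecodingMachine

variable {L : Type v} (M : DecodingMachine L)

/-- A word over `L` written on consecutive tape cells. -/
def tapeWord (x : List L) : List (Option (L ⊕ M.Work)) :=
  x.map fun a => some (Sum.inl a)

/-- Started on the input word `x`, the machine halts after at most `T` steps with the output word
`y` on its tape, read from the head to the right, and followed by blanks only. -/
def OutputsWithin (x y : List L) (T : ℕ) : Prop :=
  ∃ c : Turing.TM0.Cfg (Option (L ⊕ M.Work)) M.State,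
    Nonempty (StateTransition.EvalsToInTime (Turing.TM0.step M.machine)
      (Turing.TM0.init (M.tapeWord x)) (some c) T) ∧
    Turing.TM0.step M.machine c = none ∧
    c.Tape.right₀ = Turing.ListBlank.mk (M.tapeWord y)

/-- The machine list decodes `C` at radius `τ` within `T` steps: on every received word `w` it
writes down, one after the other, the codewords at rank distance at most `τ` from `w`. -/
def ListDecodes (K : Type u) [Field K] [Field L] [Algebra K L] {n : ℕ}
    (C : Set (Fin n → L)) (τ T : ℕ) : Prop :=
  ∀ w : Fin n → L, ∃ ℓ : List (Fin n → L),
    (∀ c, c ∈ ℓ ↔ c ∈ C ∩ rankBall K w τ) ∧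
    M.OutputsWithin (List.ofFn w) (ℓ.flatMap fun c => List.ofFn c) T

end DecodingMachine

/-- A family of rank-metric codes `C i`, of length `n i` over `L i`, is efficiently list decodable
at the radii `τ i` if every `C i` has a list decoding algorithm at radius `τ i` such that the
running times of these algorithms are bounded by one polynomial in the length `n i`. -/
def EfficientlyListDecodable {ι : Type w} (K : ι → Type u) {L : ι → Type v}
    [∀ i, Field (K i)] [∀ i, Field (L i)] [∀ i, Algebra (K i) (L i)] {n : ι → ℕ}
    (C : ∀ i, Set (Fin (n i) → L i)) (τ : ι → ℕ) : Prop :=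
  ∃ P : Polynomial ℕ, ∀ i, ∃ M : DecodingMachine (L i),
    M.ListDecodes (K i) (C i) (τ i) (P.eval (n i))

end ListDecoding

end RankMetric

end

/-!
Let `T = σ ^ t`. On `N = 𝔽_{q^n}` it has order `h + 1 + u`, where `h + 1 = p_{k-1}` and
`u = q' ^ k` are coprime, and its fixed field is `F = 𝔽_{q^t}`. Enlarging the kernel by one vector
at a time gives a monic `T`-polynomial `f` over `N` of degree `h + 1`, with nonzero constant
coefficient, such that `f(N)` has dimension at most `u` over `F`. For `γ ∈ N` nonzero and `η = β γ`,
the map `x ↦ T ^ (h + 1) (x) - T ^ (h + 1) (η) f (η⁻¹ x)` is a `T`-polynomial of degree at most `h`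
over `N(β)`, and on `β N` it differs from `T ^ (h + 1)` by a map of rank at most `t u` over `K`.
Hence it gives a codeword within `t u` of the word of `T ^ (h + 1)`, everything being twisted by
`σ ^ j`. The constant coefficients show that `γ` and `δ` give the same codeword only if
`T ^ (h + 1)` fixes `γ / δ`, that is, if `γ / δ ∈ F`. So there is a codeword for each point of
`ℙ F N`. Their number is exponential in `n`, whereas a machine fills at most one cell in each step.
-/

namespace RankMetric

open Module IntermediateField AlgEquiv
open scoped Asymptotics LinearAlgebra.Projectivization

section ListSize

section Tape

variable {Γ : Type*} [Inhabited Γ]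

/-- The positions, relative to the head, of the nonblank cells of a tape. Their number bounds the
length of a word written on the tape, and grows by at most one with each step of a machine. -/
def nonblankCells (T : Turing.Tape Γ) : Set ℤ :=
  {i | T.nth i ≠ default}

theorem encard_nonblankCells_move (T : Turing.Tape Γ) (d : Turing.Dir) :
    (nonblankCells (T.move d)).encard = (nonblankCells T).encard := by
  cases d with
  | left =>
    have hpre : nonblankCells (T.move .left) = Equiv.subRight 1 ⁻¹' nonblankCells T := by
      ext i
      simp [nonblankCells]
    rw [hpre, Set.encard_preimage_of_bijective (Equiv.bijective _)]
  | right =>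
    have hpre : nonblankCells (T.move .right) = Equiv.addRight 1 ⁻¹' nonblankCells T := by
      ext i
      simp [nonblankCells]
    rw [hpre, Set.encard_preimage_of_bijective (Equiv.bijective _)]

theorem encard_nonblankCells_write_le (T : Turing.Tape Γ) (a : Γ) :
    (nonblankCells (T.write a)).encard ≤ (nonblankCells T).encard + 1 := by
  have hsub : nonblankCells (T.write a) ⊆ insert 0 (nonblankCells T) := by
    intro i hi
    by_cases h0 : i = 0
    · exact .inl h0
    · exact .inr (by simpa [nonblankCells, h0] using hi)
  exact (Set.encard_le_encard hsub).trans (Set.encard_insert_le _ _)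

theorem encard_nonblankCells_mk₁_le (l : List Γ) :
    (nonblankCells (Turing.Tape.mk₁ l)).encard ≤ l.length := by
  have hsub : nonblankCells (Turing.Tape.mk₁ l) ⊆ (↑) '' (Finset.range l.length : Set ℕ) := by
    rintro (i | i) hi
    · refine ⟨i, ?_, rfl⟩
      contrapose! hi
      simp_all [nonblankCells, Turing.Tape.mk₁, Turing.Tape.mk₂, List.getI_eq_default]
    · simp [nonblankCells, Turing.Tape.mk₁, Turing.Tape.mk₂, Turing.Tape.mk', Turing.Tape.nth] at hi
  calc (nonblankCells (Turing.Tape.mk₁ l)).encard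
      ≤ (Finset.range l.length : Set ℕ).encard := (Set.encard_le_encard hsub).trans
        (Set.encard_image_le _ _)
    _ = l.length := by rw [Set.encard_coe_eq_coe_finsetCard, Finset.card_range]

theorem length_le_encard_nonblankCells {T : Turing.Tape Γ} {l : List Γ}
    (hl : ∀ a ∈ l, a ≠ default) (hT : T.right₀ = Turing.ListBlank.mk l) :
    l.length ≤ (nonblankCells T).encard := by
  have hsub : (↑) '' (Finset.range l.length : Set ℕ) ⊆ nonblankCells T := by
    rintro _ ⟨i, hi, rfl⟩
    have hil : i < l.length := by simpa using hi
    rw [nonblankCells, Set.mem_ofPred_eq, ← Turing.Tape.right₀_nth, hT, Turing.ListBlank.nth_mk,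
      List.getI_eq_getElem _ hil]
    exact hl _ (List.getElem_mem _)
  calc (l.length : ℕ∞) = (Finset.range l.length : Set ℕ).encard := by
        rw [Set.encard_coe_eq_coe_finsetCard, Finset.card_range]
    _ = ((↑) '' (Finset.range l.length : Set ℕ) : Set ℤ).encard :=
        (Nat.cast_injective.encard_image _).symm
    _ ≤ (nonblankCells T).encard := Set.encard_le_encard hsub

variable {Λ : Type*} [Inhabited Λ] {M : Turing.TM0.Machine Γ Λ} {c c' : Turing.TM0.Cfg Γ Λ}

theorem encard_nonblankCells_step_le (h : Turing.TM0.step M c = some c') :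
    (nonblankCells c'.Tape).encard ≤ (nonblankCells c.Tape).encard + 1 := by
  obtain ⟨q, T⟩ := c
  simp only [Turing.TM0.step, Option.map_eq_some_iff] at h
  obtain ⟨⟨q', a⟩, -, rfl⟩ := h
  cases a with
  | move d => exact (encard_nonblankCells_move T d).le.trans le_self_add
  | write a => exact encard_nonblankCells_write_le T a

theorem encard_nonblankCells_iterate_step_le {k : ℕ}
    (h : (flip bind (Turing.TM0.step M))^[k] (some c) = some c') :
    (nonblankCells c'.Tape).encard ≤ (nonblankCells c.Tape).encard + k := by
  induction k generalizing c' with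
  | zero =>
    obtain rfl : c = c' := by simpa using h
    simp
  | succ k ih =>
    rw [Function.iterate_succ_apply'] at h
    obtain ⟨b, hb, hc'⟩ := Option.bind_eq_some_iff.1 h
    calc (nonblankCells c'.Tape).encard ≤ (nonblankCells b.Tape).encard + 1 :=
          encard_nonblankCells_step_le hc'
      _ ≤ (nonblankCells c.Tape).encard + k + 1 := by gcongr; exact ih hb
      _ = (nonblankCells c.Tape).encard + (k + 1 : ℕ) := by push_cast; ring

end Tape

theorem DecodingMachine.OutputsWithin.length_le {L : Type*} {M : DecodingMachine L}
    {x y : List L} {T : ℕ} (h : M.OutputsWithin x y T) : y.length ≤ x.length + T := by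
  obtain ⟨c, ⟨e⟩, -, hc⟩ := h
  have hne : ∀ a ∈ M.tapeWord y, a ≠ default := by
    simp [DecodingMachine.tapeWord]
  have hinit : (nonblankCells (Turing.TM0.init (Λ := M.State) (M.tapeWord x)).Tape).encard ≤
      (M.tapeWord x).length := encard_nonblankCells_mk₁_le _
  have hrun := encard_nonblankCells_iterate_step_le e.evals_in_steps
  have hcells : ((M.tapeWord y).length : ℕ∞) ≤ (M.tapeWord x).length + e.steps :=
    (length_le_encard_nonblankCells hne hc).trans (hrun.trans (by gcongr))
  have hlen : (M.tapeWord y).length ≤ (M.tapeWord x).length + e.steps := by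
    exact_mod_cast hcells
  simp only [DecodingMachine.tapeWord, List.length_map] at hlen
  exact hlen.trans (Nat.add_le_add_left e.steps_le_m _)

theorem DecodingMachine.ListDecodes.ncard_mul_le {K L : Type*} [Field K] [Field L] [Algebra K L]
    {n τ T : ℕ} {M : DecodingMachine L} {C : Set (Fin n → L)} (h : M.ListDecodes K C τ T)
    (w : Fin n → L) : (C ∩ rankBall K w τ).ncard * n ≤ n + T := by
  classical
  obtain ⟨ℓ, hℓ, hout⟩ := h w
  have hset : C ∩ rankBall K w τ = (ℓ.toFinset : Set (Fin n → L)) := by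
    ext c
    simp [hℓ]
  have hcard : (C ∩ rankBall K w τ).ncard ≤ ℓ.length := by
    rw [hset, Set.ncard_coe_finset]
    exact ℓ.toFinset_card_le
  calc (C ∩ rankBall K w τ).ncard * n ≤ ℓ.length * n := Nat.mul_le_mul_right n hcard
    _ = (ℓ.flatMap fun c => List.ofFn c).length := by simp [List.length_flatMap]
    _ ≤ n + T := by simpa using hout.length_le

variable {ι : Type*} {K L : ι → Type*} [∀ i, Field (K i)] [∀ i, Field (L i)]
  [∀ i, Algebra (K i) (L i)] {n τ : ι → ℕ} {C : ∀ i, Set (Fin (n i) → L i)}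

theorem EfficientlyListDecodable.exists_polynomial_ncard_le
    (h : EfficientlyListDecodable K C τ) :
    ∃ P : Polynomial ℕ, ∀ i w, (C i ∩ rankBall (K i) w (τ i)).ncard ≤ P.eval (n i) := by
  obtain ⟨P, hP⟩ := h
  refine ⟨Polynomial.X + P + 1, fun i w => ?_⟩
  obtain ⟨M, hM⟩ := hP i
  have hmul := hM.ncard_mul_le w
  simp only [Polynomial.eval_add, Polynomial.eval_X, Polynomial.eval_one]
  rcases Nat.eq_zero_or_pos (n i) with hn | hn
  · have : IsEmpty (Fin (n i)) := hn ▸ Fin.isEmpty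
    exact (Set.ncard_le_one_of_subsingleton _).trans (Nat.le_add_left _ _)
  · exact ((Nat.le_mul_of_pos_right _ hn).trans hmul).trans (Nat.le_succ _)

theorem isLittleO_polynomial_eval_const_pow (P : Polynomial ℕ) {r : ℝ} (hr : 1 < r) :
    (fun n : ℕ => ((P.eval n : ℕ) : ℝ)) =o[Filter.atTop] fun n : ℕ => r ^ n := by
  induction P using Polynomial.induction_on' with
  | add P Q hP hQ => simpa using hP.add hQ
  | monomial k a =>
    simpa using (isLittleO_pow_const_const_pow_of_one_lt k hr).const_mul_left (a : ℝ)

theorem eventually_polynomial_eval_lt_pow (P : Polynomial ℕ) {b : ℕ} (hb : 1 < b) (k : ℕ) :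
    ∀ᶠ n : ℕ in Filter.atTop, ∀ m, n ≤ k * m → P.eval n < b ^ m := by
  have hlittle := isLittleO_polynomial_eval_const_pow (P ^ k) (r := b) (mod_cast hb)
  filter_upwards [hlittle.bound (c := 1 / 2) (by norm_num)] with n hn m hnm
  have hpow : (0 : ℝ) < (b : ℝ) ^ n := by positivity
  rw [Real.norm_natCast, Real.norm_of_nonneg hpow.le, Polynomial.eval_pow] at hn
  have hlt : ((P.eval n ^ k : ℕ) : ℝ) < ((b ^ n : ℕ) : ℝ) := by
    push_cast at hn ⊢
    linarith
  refine lt_of_pow_lt_pow_left₀ k (by positivity) ((Nat.cast_lt.1 hlt).trans_le ?_)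
  rw [← pow_mul, mul_comm m]
  exact Nat.pow_le_pow_right (by lia) hnm

theorem not_efficientlyListDecodable_of_pow_le_ncard {b k : ℕ} (hb : 1 < b) (m : ι → ℕ)
    (hm : ∀ i, n i ≤ k * m i) (hunb : ∀ B, ∃ i, B ≤ n i)
    (hC : ∀ i, ∃ w, b ^ m i ≤ (C i ∩ rankBall (K i) w (τ i)).ncard) :
    ¬ EfficientlyListDecodable K C τ := by
  intro h
  obtain ⟨P, hP⟩ := h.exists_polynomial_ncard_le
  obtain ⟨B, hB⟩ := Filter.eventually_atTop.1 (eventually_polynomial_eval_lt_pow P hb k)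
  obtain ⟨i, hi⟩ := hunb B
  obtain ⟨w, hw⟩ := hC i
  exact (hB (n i) hi (m i) (hm i)).not_ge (hw.trans (hP i w))

end ListSize

section SigmaPolynomialAlgebra

variable {K L : Type*} [Field K] [Field L] [Algebra K L]

theorem sigmaPoly_apply (σ : L ≃ₐ[K] L) {h : ℕ} (a : Fin h → L) (x : L) :
    sigmaPoly σ h a x = ∑ i, a i * (σ ^ (i : ℕ)) x := by
  simp [sigmaPoly]

theorem eq_of_sigmaPoly_apply_eq {A : Type*} [Semiring A] [Algebra K A] (φ : A →ₐ[K] L)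
    {σ : L ≃ₐ[K] L} {h : ℕ} {a b : Fin h → L}
    (hφ : Function.Injective fun i : Fin h => ((σ ^ (i : ℕ) : L ≃ₐ[K] L) : L →ₐ[K] L).comp φ)
    (hab : ∀ x, sigmaPoly σ h a (φ x) = sigmaPoly σ h b (φ x)) : a = b := by
  have hindep := (linearIndependent_toLinearMap K A L).comp _ hφ
  rw [Fintype.linearIndependent_iff] at hindep
  ext i
  refine sub_eq_zero.1 (hindep (a - b) ?_ i)
  ext x
  simpa [sigmaPoly_apply, sub_mul, sub_eq_zero] using hab x

theorem sigmaPoly_injective {σ : L ≃ₐ[K] L} {h : ℕ} (hh : h ≤ orderOf σ) :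
    Function.Injective (sigmaPoly σ h) := by
  refine fun a b hab => eq_of_sigmaPoly_apply_eq (AlgHom.id K L) (fun i j hij => ?_)
    fun x => LinearMap.congr_fun hab x
  exact Fin.ext (pow_injOn_Iio_orderOf (i.2.trans_le hh) (j.2.trans_le hh)
    (AlgEquiv.coe_toAlgHom_injective hij))

theorem coe_restrictNormalHom_pow_apply (N : IntermediateField K L) [Normal K N] (σ : L ≃ₐ[K] L)
    (i : ℕ) (x : N) : ((restrictNormalHom N σ ^ i) x : L) = (σ ^ i) x := by
  rw [← map_pow, restrictNormalHom_apply]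

theorem eq_of_sigmaPoly_mul_eq {N : IntermediateField K L} [Normal K N] {σ : L ≃ₐ[K] L} {h : ℕ}
    (hh : h ≤ orderOf (restrictNormalHom N σ)) {β : L} (hβ : β ≠ 0) {a b : Fin h → L}
    (hab : ∀ x ∈ N, sigmaPoly σ h a (β * x) = sigmaPoly σ h b (β * x)) : a = b := by
  have hinj : Function.Injective
      fun i : Fin h => ((σ ^ (i : ℕ) : L ≃ₐ[K] L) : L →ₐ[K] L).comp N.val := by
    intro i j hij
    have hpow : restrictNormalHom N σ ^ (i : ℕ) = restrictNormalHom N σ ^ (j : ℕ) := by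
      ext x
      rw [coe_restrictNormalHom_pow_apply, coe_restrictNormalHom_pow_apply]
      exact DFunLike.congr_fun hij x
    exact Fin.ext (pow_injOn_Iio_orderOf (i.2.trans_le hh) (j.2.trans_le hh) hpow)
  have hmul : (fun i => a i * (σ ^ (i : ℕ)) β) = fun i => b i * (σ ^ (i : ℕ)) β :=
    eq_of_sigmaPoly_apply_eq N.val hinj fun x => by
      simpa [sigmaPoly_apply, mul_assoc] using hab x x.2
  ext i
  exact mul_right_cancel₀ ((map_ne_zero_iff _ (σ ^ (i : ℕ)).injective).2 hβ) (congrFun hmul i)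

section SmallRange

theorem sigmaPoly_cons_sub_smul_snoc (σ : L ≃ₐ[K] L) {h : ℕ} (a : Fin h → L) (c : L) :
    sigmaPoly σ (h + 1) (Fin.cons 0 (σ ∘ a) - c • (Fin.snoc a 0 : Fin (h + 1) → L)) =
      (σ.toLinearMap - LinearMap.mulLeft K c) ∘ₗ sigmaPoly σ h a := by
  ext x
  have hcons : ∑ i, (Fin.cons 0 (σ ∘ a) : Fin (h + 1) → L) i * (σ ^ (i : ℕ)) x =
      σ (sigmaPoly σ h a x) := by
    simp [sigmaPoly_apply, Fin.sum_univ_succ, pow_succ', -AlgEquiv.coe_pow]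
  have hsnoc : ∑ i, (Fin.snoc a 0 : Fin (h + 1) → L) i * (σ ^ (i : ℕ)) x =
      sigmaPoly σ h a x := by
    simp [sigmaPoly_apply, Fin.sum_univ_castSucc]
  simp only [sigmaPoly_apply σ (Fin.cons 0 (σ ∘ a) - _), Pi.sub_apply, Pi.smul_apply, smul_eq_mul,
    sub_mul, mul_assoc, Finset.sum_sub_distrib, ← Finset.mul_sum, hcons, hsnoc]
  rfl

theorem exists_le_finrank_ker_sigmaPoly [FiniteDimensional K L] (σ : L ≃ₐ[K] L) {e : ℕ}
    (he : e < orderOf σ) :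
    ∃ a : Fin (e + 1) → L, a 0 ≠ 0 ∧ a (Fin.last e) = 1 ∧
      e ≤ finrank K (LinearMap.ker (sigmaPoly σ (e + 1) a)) := by
  induction e with
  | zero => exact ⟨1, one_ne_zero, rfl, Nat.zero_le _⟩
  | succ e ih =>
    obtain ⟨a, ha₀, ha₁, hker⟩ := ih (by lia)
    set f := sigmaPoly σ (e + 1) a with hf
    have hf₀ : f ≠ 0 := fun h => ha₀ <| congrFun
      (sigmaPoly_injective he.le (h.trans (by simp [sigmaPoly]) : f = sigmaPoly σ (e + 1) 0)) 0
    obtain ⟨v, hv⟩ : ∃ v, f v ≠ 0 := by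
      contrapose! hf₀
      exact LinearMap.ext hf₀
    -- Composing with `x ↦ σ x - c x`, which kills `f v`, enlarges the kernel by `v`.
    set c := σ (f v) / f v with hc
    have hc₀ : c ≠ 0 := div_ne_zero (by simpa using hv) hv
    refine ⟨Fin.cons 0 (σ ∘ a) - c • (Fin.snoc a 0 : Fin (e + 2) → L), ?_, ?_, ?_⟩
    · simp [hc₀, ha₀, Fin.snoc]
    · have hcons : (Fin.cons 0 (σ ∘ a) : Fin (e + 2) → L) (Fin.last (e + 1)) = 1 := by
        simp [← Fin.succ_last, ha₁]
      simp [hcons]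
    · rw [sigmaPoly_cons_sub_smul_snoc σ a c, ← hf]
      refine hker.trans_lt (Submodule.finrank_lt_finrank_of_lt ?_)
      refine SetLike.lt_iff_le_and_exists.2
        ⟨LinearMap.ker_le_ker_comp _ _, v, ?_, by simpa using hv⟩
      simp [hc, hv]

theorem finrank_fixedField_zpowers_mul_orderOf [FiniteDimensional K L] (σ : L ≃ₐ[K] L) :
    finrank K (fixedField (Subgroup.zpowers σ)) * orderOf σ = finrank K L := by
  rw [← Nat.card_zpowers, ← finrank_fixedField_eq_card, finrank_mul_finrank]

theorem exists_finrank_range_sigmaPoly_le [FiniteDimensional K L] (σ : L ≃ₐ[K] L) {e : ℕ}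
    (he : e < orderOf σ) :
    ∃ a : Fin (e + 1) → L, a 0 ≠ 0 ∧ a (Fin.last e) = 1 ∧
      finrank K (LinearMap.range (sigmaPoly σ (e + 1) a)) ≤
        finrank K (fixedField (Subgroup.zpowers σ)) * (orderOf σ - e) := by
  set F := fixedField (Subgroup.zpowers σ) with hF
  have hσF : σ ∈ F.fixingSubgroup := by
    rw [hF, fixingSubgroup_fixedField]
    exact Subgroup.mem_zpowers σ
  set σF : L ≃ₐ[F] L := fixingSubgroupEquiv F ⟨σ, hσF⟩
  have hord : orderOf σF = orderOf σ := by
    rw [MulEquiv.orderOf_eq, Subgroup.orderOf_mk]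
  have hpow : ∀ (i : ℕ) x, (σF ^ i) x = (σ ^ i) x := fun i x => by
    rw [← map_pow]
    rfl
  obtain ⟨a, ha₀, ha₁, hker⟩ := exists_le_finrank_ker_sigmaPoly σF (hord.symm ▸ he)
  refine ⟨a, ha₀, ha₁, ?_⟩
  have hrestrict : (sigmaPoly σF (e + 1) a).restrictScalars K = sigmaPoly σ (e + 1) a := by
    ext x
    simp [sigmaPoly_apply, hpow]
  have hrange : finrank K (LinearMap.range (sigmaPoly σ (e + 1) a)) =
      finrank K F * finrank F (LinearMap.range (sigmaPoly σF (e + 1) a)) := by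
    rw [finrank_mul_finrank, ← hrestrict]
    rfl
  have hrankNullity := LinearMap.finrank_range_add_finrank_ker (sigmaPoly σF (e + 1) a)
  rw [finrank_fixedField_eq_card, Nat.card_zpowers] at hrankNullity
  rw [hrange]
  exact Nat.mul_le_mul_left _ (by lia)

theorem exists_finrank_map_sigmaPoly_le (N : IntermediateField K L) [FiniteDimensional K N]
    [Normal K N] (σ : L ≃ₐ[K] L) {e : ℕ} (he : e < orderOf (restrictNormalHom N σ)) :
    ∃ a : Fin (e + 1) → L, (∀ i, a i ∈ N) ∧ a 0 ≠ 0 ∧ a (Fin.last e) = 1 ∧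
      finrank K (N.toSubalgebra.toSubmodule.map (sigmaPoly σ (e + 1) a)) ≤
        finrank K (fixedField (Subgroup.zpowers (restrictNormalHom N σ))) *
          (orderOf (restrictNormalHom N σ) - e) := by
  obtain ⟨a, ha₀, ha₁, hrange⟩ := exists_finrank_range_sigmaPoly_le _ he
  refine ⟨fun i => a i, fun i => (a i).2, by simpa using ha₀, by simp [ha₁], ?_⟩
  have hcomm : ∀ x : N, sigmaPoly σ (e + 1) (fun i => (a i : L)) x =
      N.val (sigmaPoly (restrictNormalHom N σ) (e + 1) a x) := by
    simp [sigmaPoly_apply, coe_restrictNormalHom_pow_apply, -AlgEquiv.coe_pow]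
  have hmap : N.toSubalgebra.toSubmodule.map (sigmaPoly σ (e + 1) fun i => (a i : L)) =
      (LinearMap.range (sigmaPoly (restrictNormalHom N σ) (e + 1) a)).map N.val.toLinearMap := by
    ext y
    constructor
    · rintro ⟨x, hx, rfl⟩
      exact ⟨_, ⟨⟨x, hx⟩, rfl⟩, (hcomm ⟨x, hx⟩).symm⟩
    · rintro ⟨_, ⟨x, rfl⟩, rfl⟩
      exact ⟨x, x.2, hcomm x⟩
  rw [hmap]
  exact (Submodule.finrank_map_le _ _).trans hrange

end SmallRange

end SigmaPolynomialAlgebra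

section RankBall

variable {K L : Type*} [Field K] [Field L] [Algebra K L] {n : ℕ}

theorem rankWeight_comp (g : L →ₗ[K] L) (α : Fin n → L) :
    rankWeight K (fun i => g (α i)) =
      finrank K ((Submodule.span K (Set.range α)).map g) := by
  rw [rankWeight, Submodule.map_span, ← Set.range_comp]
  rfl

theorem notMem_of_rankDist_lt_minDist {C : Set (Fin n → L)} {w c : Fin n → L} (hc : c ∈ C)
    (hne : w ≠ c) (h : rankDist K w c < minDist K C) : w ∉ C :=
  fun hw => h.not_ge (Nat.sInf_le ⟨w, hw, c, hc, hne, rfl⟩)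

end RankBall

section Conjugation

variable {K L : Type*} [Field K] [Field L] [Algebra K L] {σ : L ≃ₐ[K] L} {h : ℕ}
  {a : Fin (h + 1) → L} {η θ : L}

/-- For the `σ`-polynomial `f` of degree `h` with coefficients `a`, the coefficients of the
`σ`-polynomial `x ↦ σ ^ h (η) f (η⁻¹ x)`. The factor `σ ^ h (η)` keeps monic polynomials monic. -/
def conjCoeff (σ : L ≃ₐ[K] L) (a : Fin (h + 1) → L) (η : L) : Fin (h + 1) → L :=
  fun i => (σ ^ h) η * a i * (σ ^ (i : ℕ)) η⁻¹

theorem sigmaPoly_conjCoeff (hη : η ≠ 0) :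
    sigmaPoly σ (h + 1) (conjCoeff σ a η) ∘ₗ LinearMap.mulLeft K η =
      LinearMap.mulLeft K ((σ ^ h) η) ∘ₗ sigmaPoly σ (h + 1) a := by
  ext x
  have hcancel : ∀ i : ℕ, (σ ^ i) η⁻¹ * (σ ^ i) (η * x) = (σ ^ i) x := fun i => by
    rw [← map_mul, inv_mul_cancel_left₀ hη]
  simp only [LinearMap.comp_apply, LinearMap.mulLeft_apply, sigmaPoly_apply, conjCoeff,
    mul_assoc, hcancel, Finset.mul_sum]

theorem conjCoeff_last (ha : a (Fin.last h) = 1) (hη : η ≠ 0) :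
    conjCoeff σ a η (Fin.last h) = 1 := by
  rw [conjCoeff, ha, mul_one, Fin.val_last, ← map_mul, mul_inv_cancel₀ hη, map_one]

theorem conjCoeff_mem {E : IntermediateField K L} [Normal K E] (ha : ∀ i, a i ∈ E) (hη : η ∈ E)
    (i : Fin (h + 1)) : conjCoeff σ a η i ∈ E := by
  have hstable : ∀ (τ : L ≃ₐ[K] L) {x : L}, x ∈ E → τ x ∈ E := fun τ x hx =>
    restrictNormalHom_apply E τ ⟨x, hx⟩ ▸ SetLike.coe_mem (restrictNormalHom E τ ⟨x, hx⟩)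
  exact mul_mem (mul_mem (hstable _ hη) (ha i)) (hstable _ (inv_mem hη))

theorem pow_apply_div_eq_of_conjCoeff_eq (ha : a 0 ≠ 0) (hη : η ≠ 0) (hθ : θ ≠ 0)
    (heq : conjCoeff σ a η = conjCoeff σ a θ) : (σ ^ h) (η / θ) = η / θ := by
  have hzero := congrFun heq 0
  have hσθ : (σ ^ h) θ ≠ 0 := (map_ne_zero_iff _ (σ ^ h).injective).2 hθ
  simp only [conjCoeff, Fin.val_zero, pow_zero, AlgEquiv.one_apply] at hzero
  rw [map_div₀, div_eq_div_iff hσθ hθ]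
  field_simp at hzero
  linear_combination hzero

theorem finrank_map_sigmaPoly_conjCoeff_le (V : Submodule K L) [FiniteDimensional K V]
    (hη : η ≠ 0) :
    finrank K ((V.map (LinearMap.mulLeft K η)).map (sigmaPoly σ (h + 1) (conjCoeff σ a η))) ≤
      finrank K (V.map (sigmaPoly σ (h + 1) a)) := by
  rw [← Submodule.map_comp, sigmaPoly_conjCoeff hη, Submodule.map_comp]
  exact Submodule.finrank_map_le _ _

theorem map_mulLeft_mul_of_mem (N : IntermediateField K L) (β : L) {γ : L} (hγ : γ ∈ N)
    (hγ₀ : γ ≠ 0) :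
    N.toSubalgebra.toSubmodule.map (LinearMap.mulLeft K (β * γ)) =
      N.toSubalgebra.toSubmodule.map (LinearMap.mulLeft K β) := by
  ext y
  constructor
  · rintro ⟨x, hx, rfl⟩
    exact ⟨γ * x, N.mul_mem hγ hx, (mul_assoc β γ x).symm⟩
  · rintro ⟨x, hx, rfl⟩
    refine ⟨γ⁻¹ * x, N.mul_mem (N.inv_mem hγ) hx, ?_⟩
    simp [mul_inv_cancel_left₀ hγ₀]

end Conjugation

section ListConstruction

variable {K L : Type*} [Field K] [Field L] [Algebra K L]

theorem mem_fixedField_zpowers_of_pow_apply_eq {σ : L ≃ₐ[K] L} {k : ℕ}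
    (hk : k.Coprime (orderOf σ)) {x : L} (hx : (σ ^ k) x = x) :
    x ∈ fixedField (Subgroup.zpowers σ) := by
  have hpow : Subgroup.zpowers (σ ^ k) ≤ MulAction.stabilizer (L ≃ₐ[K] L) x :=
    Subgroup.zpowers_le.2 hx
  have hstab : Subgroup.zpowers σ ≤ MulAction.stabilizer (L ≃ₐ[K] L) x :=
    Subgroup.zpowers_le.2 (hpow (mem_zpowers_pow_iff.2 hk))
  exact (mem_fixedField_iff _ _).2 fun g hg => hstab hg

theorem card_projectivization_le_ncard {F V X : Type*} [DivisionRing F] [AddCommGroup V]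
    [Module F V] {S : Set X} (hS : S.Finite) {c : V → X} (hc : ∀ v ≠ 0, c v ∈ S)
    (hinj : ∀ v w, v ≠ 0 → w ≠ 0 → c v = c w → ∃ a : F, a • w = v) :
    Nat.card (ℙ F V) ≤ S.ncard := by
  have hrep : Function.Injective fun P : ℙ F V => c P.rep := by
    intro P Q hPQ
    rw [← P.mk_rep, ← Q.mk_rep, Projectivization.mk_eq_mk_iff']
    exact hinj _ _ P.rep_nonzero Q.rep_nonzero hPQ
  rw [← Set.ncard_range_of_injective hrep]
  exact Set.ncard_le_ncard (Set.range_subset_iff.2 fun P => hc _ P.rep_nonzero) hS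

/-- For the `σ`-polynomial `f` of degree `h` with coefficients `a`, the map
`x ↦ φ (σ ^ h (x) - σ ^ h (η) f (η⁻¹ x))`. If `f` is monic then the top terms cancel, and if `f` has
small image then the map is close to `φ ∘ σ ^ h` in the rank metric. -/
def listMap (σ : L ≃ₐ[K] L) (φ : L →ₗ[K] L) {h : ℕ} (a : Fin (h + 1) → L) (η : L) : L →ₗ[K] L :=
  φ ∘ₗ ((σ ^ h).toLinearMap - sigmaPoly σ (h + 1) (conjCoeff σ a η))

variable {N : IntermediateField K L} {σ : L ≃ₐ[K] L} {φ : L →ₗ[K] L} {h m : ℕ}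
  {a : Fin (h + 1) → L} {α : Fin m → L} {β : L}

theorem rankDist_listMap_le [FiniteDimensional K N] (hβ : β ≠ 0)
    (hspan : Submodule.span K (Set.range α) =
      N.toSubalgebra.toSubmodule.map (LinearMap.mulLeft K β)) {γ : L} (hγ : γ ∈ N) (hγ₀ : γ ≠ 0) :
    rankDist K (fun i => φ ((σ ^ h) (α i))) (fun i => listMap σ φ a (β * γ) (α i)) ≤
      finrank K (N.toSubalgebra.toSubmodule.map (sigmaPoly σ (h + 1) a)) := by
  have hdiff : (fun i => φ ((σ ^ h) (α i))) - (fun i => listMap σ φ a (β * γ) (α i)) =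
      fun i => (φ ∘ₗ sigmaPoly σ (h + 1) (conjCoeff σ a (β * γ))) (α i) := by
    ext i
    simp [listMap]
  rw [rankDist, hdiff, rankWeight_comp, hspan, ← map_mulLeft_mul_of_mem N β hγ hγ₀,
    Submodule.map_comp]
  have : FiniteDimensional K N.toSubalgebra.toSubmodule := ‹FiniteDimensional K N›
  exact (Submodule.finrank_map_le _ _).trans
    (finrank_map_sigmaPoly_conjCoeff_le _ (mul_ne_zero hβ hγ₀))

theorem apply_mul_eq_of_span_range_eq {f g : L →ₗ[K] L} (hspan : Submodule.span K (Set.range α) =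
      N.toSubalgebra.toSubmodule.map (LinearMap.mulLeft K β))
    (hfg : (fun i => f (α i)) = fun i => g (α i)) {x : L} (hx : x ∈ N) :
    f (β * x) = g (β * x) := by
  have heq : Set.EqOn f g (Submodule.span K (Set.range α)) :=
    LinearMap.eqOn_span (Set.forall_mem_range.2 (congrFun hfg))
  exact heq (hspan ▸ ⟨x, hx, rfl⟩)

theorem conjCoeff_eq_of_listMap_eq [Normal K N] (hh : h < orderOf (restrictNormalHom N σ))
    (hφ : Function.Injective φ) (hβ : β ≠ 0)
    (hspan : Submodule.span K (Set.range α) =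
      N.toSubalgebra.toSubmodule.map (LinearMap.mulLeft K β)) {η θ : L}
    (heq : (fun i => listMap σ φ a η (α i)) = fun i => listMap σ φ a θ (α i)) :
    conjCoeff σ a η = conjCoeff σ a θ := by
  refine eq_of_sigmaPoly_mul_eq hh hβ fun x hx => ?_
  simpa [listMap, hφ.eq_iff] using apply_mul_eq_of_span_range_eq hspan heq hx

theorem ne_listMap [Normal K N] (hh : h < orderOf (restrictNormalHom N σ))
    (hφ : Function.Injective φ) (ha : a (Fin.last h) = 1) (hβ : β ≠ 0)
    (hspan : Submodule.span K (Set.range α) =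
      N.toSubalgebra.toSubmodule.map (LinearMap.mulLeft K β)) {η : L} (hη : η ≠ 0) :
    (fun i => φ ((σ ^ h) (α i))) ≠ fun i => listMap σ φ a η (α i) := by
  intro heq
  have hzero : conjCoeff σ a η = 0 := by
    refine eq_of_sigmaPoly_mul_eq hh hβ fun x hx => ?_
    have hcancel : (σ ^ h) (β * x) =
        (σ ^ h) (β * x) - sigmaPoly σ (h + 1) (conjCoeff σ a η) (β * x) :=
      hφ (apply_mul_eq_of_span_range_eq (f := φ ∘ₗ (σ ^ h).toLinearMap) hspan heq hx)
    rw [sub_eq_self.1 hcancel.symm]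
    simp [sigmaPoly]
  exact one_ne_zero ((conjCoeff_last ha hη).symm.trans (congrFun hzero _))

theorem exists_smul_eq_of_listMap_eq [Normal K N] (hh : h < orderOf (restrictNormalHom N σ))
    (hcop : h.Coprime (orderOf (restrictNormalHom N σ))) (hφ : Function.Injective φ)
    (ha : a 0 ≠ 0) (hβ : β ≠ 0)
    (hspan : Submodule.span K (Set.range α) =
      N.toSubalgebra.toSubmodule.map (LinearMap.mulLeft K β)) {γ δ : N} (hγ : γ ≠ 0) (hδ : δ ≠ 0)
    (heq : (fun i => listMap σ φ a (β * γ) (α i)) = fun i => listMap σ φ a (β * δ) (α i)) :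
    ∃ c : fixedField (Subgroup.zpowers (restrictNormalHom N σ)), c • δ = γ := by
  have hγ' : (γ : L) ≠ 0 := by simpa using hγ
  have hδ' : (δ : L) ≠ 0 := by simpa using hδ
  have hfix := pow_apply_div_eq_of_conjCoeff_eq ha (mul_ne_zero hβ hγ') (mul_ne_zero hβ hδ')
    (conjCoeff_eq_of_listMap_eq hh hφ hβ hspan heq)
  rw [mul_div_mul_left _ _ hβ] at hfix
  refine ⟨⟨γ / δ, mem_fixedField_zpowers_of_pow_apply_eq hcop (Subtype.ext ?_)⟩, ?_⟩
  · rw [coe_restrictNormalHom_pow_apply]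
    exact hfix
  · exact div_mul_cancel₀ γ hδ

theorem exists_notMem_card_projectivization_le_ncard [Finite L]
    (hh : h < orderOf (restrictNormalHom N σ))
    (hcop : h.Coprime (orderOf (restrictNormalHom N σ))) (hφ : Function.Injective φ) (hβ : β ≠ 0)
    (hspan : Submodule.span K (Set.range α) =
      N.toSubalgebra.toSubmodule.map (LinearMap.mulLeft K β)) {𝒞 : Set (L →ₗ[K] L)}
    (h𝒞 : ∀ b : Fin (h + 1) → L, (∀ i, b i ∈ N ⊔ adjoin K {β}) → b (Fin.last h) = 1 →
      φ ∘ₗ ((σ ^ h).toLinearMap - sigmaPoly σ (h + 1) b) ∈ 𝒞) {δ r : ℕ}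
    (hδ : finrank K (fixedField (Subgroup.zpowers (restrictNormalHom N σ))) *
      (orderOf (restrictNormalHom N σ) - h) ≤ δ)
    (hd : δ < minDist K (evalCode α 𝒞)) (hr : δ ≤ r) :
    ∃ w ∉ evalCode α 𝒞,
      Nat.card (ℙ (fixedField (Subgroup.zpowers (restrictNormalHom N σ))) N) ≤
        (evalCode α 𝒞 ∩ rankBall K w r).ncard := by
  obtain ⟨a, haN, ha₀, ha₁, hrank⟩ := exists_finrank_map_sigmaPoly_le N σ hh
  have hcode : ∀ γ : N, γ ≠ 0 → (fun i => listMap σ φ a (β * γ) (α i)) ∈ evalCode α 𝒞 := by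
    intro γ hγ
    have hβE : β ∈ N ⊔ adjoin K {β} := le_sup_right (a := N) (mem_adjoin_simple_self K β)
    refine ⟨_, h𝒞 _ (conjCoeff_mem (fun i => le_sup_left (a := N) (haN i))
      (mul_mem hβE (le_sup_left (a := N) γ.2))) (conjCoeff_last ha₁ (mul_ne_zero hβ ?_)), rfl⟩
    simpa using hγ
  have hdist : ∀ γ : N, γ ≠ 0 → rankDist K (fun i => φ ((σ ^ h) (α i)))
      (fun i => listMap σ φ a (β * γ) (α i)) ≤ δ := fun γ hγ =>
    (rankDist_listMap_le hβ hspan γ.2 (by simpa using hγ)).trans (hrank.trans hδ)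
  refine ⟨fun i => φ ((σ ^ h) (α i)), ?_, ?_⟩
  · refine notMem_of_rankDist_lt_minDist (hcode 1 one_ne_zero) ?_
      ((hdist 1 one_ne_zero).trans_lt hd)
    exact ne_listMap hh hφ ha₁ hβ hspan (by simpa using hβ)
  · exact card_projectivization_le_ncard (Set.toFinite _)
      (fun γ hγ => ⟨hcode γ hγ, (hdist γ hγ).trans hr⟩)
      fun _ _ hγ hγ' => exists_smul_eq_of_listMap_eq hh hcop hφ ha₀ hβ hspan hγ hγ'

end ListConstruction

section Gabidulin

variable {K L : Type*} [Field K] [Field L] [Algebra K L]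

theorem sum_smul_pow_mem_gabidulin {ι : Type*} [Fintype ι] (σ : L ≃ₐ[K] L)
    {E : IntermediateField K L} {h : ℕ} (k : ι → Fin h) {a : ι → L} (ha : ∀ i, a i ∈ E) :
    ∑ i, a i • (σ ^ (k i : ℕ)).toLinearMap ∈ gabidulin σ E h := by
  classical
  refine ⟨fun j => ∑ i with k i = j, a i, fun j => sum_mem fun i _ => ha i, ?_⟩
  simp only [sigmaPoly, Finset.sum_smul]
  rw [← Finset.sum_fiberwise Finset.univ k]
  refine Finset.sum_congr rfl fun j _ => Finset.sum_congr rfl fun i hi => ?_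
  rw [(Finset.mem_filter.1 hi).2]

theorem pow_sub_sigmaPoly_mem_gabidulin (σ : L ≃ₐ[K] L) {E : IntermediateField K L} {h t : ℕ}
    {a : Fin (h + 2) → L} (ha : ∀ i, a i ∈ E) (hlast : a (Fin.last (h + 1)) = 1) :
    ((σ ^ t) ^ (h + 1)).toLinearMap - sigmaPoly (σ ^ t) (h + 2) a ∈
      gabidulin σ E (t * h + 1) := by
  have hexp : ∀ i : Fin (h + 1), t * i < t * h + 1 := fun i =>
    Nat.lt_succ_of_le (Nat.mul_le_mul_left t (Fin.is_le i))
  convert sum_smul_pow_mem_gabidulin σ (fun i : Fin (h + 1) => ⟨t * i, hexp i⟩)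
    (a := fun i => -a i.castSucc) (fun i => E.neg_mem (ha _)) using 1
  ext x
  simp [sigmaPoly_apply, Fin.sum_univ_castSucc (n := h + 1), hlast, pow_mul, -AlgEquiv.coe_pow]

end Gabidulin

section Order

variable {K L : Type*} [Field K] [Field L] [Algebra K L] [Finite L]

theorem orderOf_restrictNormalHom_eq_finrank (N : IntermediateField K L) {σ : L ≃ₐ[K] L} {s : ℕ}
    (hσ : ∀ x, σ x = x ^ Nat.card K ^ s) (hs : s.Coprime (finrank K N)) :
    orderOf (restrictNormalHom N σ) = finrank K N := by
  have : Finite K := Finite.of_injective _ (algebraMap K L).injective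
  have : Fintype K := Fintype.ofFinite K
  have hfrob : restrictNormalHom N σ = FiniteField.frobeniusAlgEquivOfAlgebraic K N ^ s := by
    ext x
    rw [restrictNormalHom_apply, hσ, AlgEquiv.coe_pow,
      FiniteField.coe_frobeniusAlgEquivOfAlgebraic_iterate, Nat.card_eq_fintype_card]
    rfl
  have hord := FiniteField.orderOf_frobeniusAlgEquivOfAlgebraic K N
  rw [hfrob, Nat.Coprime.orderOf_pow (by rwa [hord, Nat.coprime_comm]), hord]

end Order

section SingleCode

variable {K L : Type*} [Field K] [Field L] [Algebra K L] [Finite L]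

theorem exists_notMem_le_ncard_inter_rankBall {N : IntermediateField K L} {σ : L ≃ₐ[K] L}
    (hσ : orderOf (restrictNormalHom N σ) = finrank K N) {t h u n : ℕ} (ht : 0 < t) (hu : 0 < u)
    (hN : finrank K N = n) (hn : n = t * (h + 1 + u)) (hcop : (h + 1).Coprime u) {β : L}
    (hβ : β ≠ 0) {m : ℕ} {α : Fin m → L} (hspan : Submodule.span K (Set.range α) =
      N.toSubalgebra.toSubmodule.map (LinearMap.mulLeft K β)) {𝒞 : Set (L →ₗ[K] L)}
    (hd : t * u < minDist K (evalCode α 𝒞)) {j : ℕ}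
    (h𝒞 : sigmaTwist σ j (gabidulin σ (N ⊔ adjoin K {β}) (t * h + 1)) ⊆ 𝒞) {r : ℕ}
    (hr : t * u ≤ r) :
    ∃ w ∉ evalCode α 𝒞, (Nat.card K ^ n - 1) / (Nat.card K ^ t - 1) ≤
      (evalCode α 𝒞 ∩ rankBall K w r).ncard := by
  subst hN
  have : Finite K := Finite.of_injective _ (algebraMap K L).injective
  set F := fixedField (Subgroup.zpowers (restrictNormalHom N (σ ^ t))) with hF
  have hord : orderOf (restrictNormalHom N (σ ^ t)) = h + 1 + u := by
    rw [map_pow, orderOf_pow_of_dvd ht.ne' (by simp [hσ, hn]), hσ, hn, Nat.mul_div_cancel_left _ ht]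
  have hFt : finrank K F = t := by
    have hmul := finrank_fixedField_zpowers_mul_orderOf (restrictNormalHom N (σ ^ t))
    rw [hord, hn] at hmul
    exact Nat.eq_of_mul_eq_mul_right (by lia) hmul
  have hcard : Nat.card (ℙ F N) = (Nat.card K ^ finrank K N - 1) / (Nat.card K ^ t - 1) := by
    rw [Projectivization.card'' F N, natCard_eq_pow_finrank (K := K) (V := N),
      natCard_eq_pow_finrank (K := K) (V := F), hFt]
  rw [← hcard]
  refine exists_notMem_card_projectivization_le_ncard (φ := (σ ^ j).toLinearMap) (by lia)
    ?_ (σ ^ j).injective hβ hspan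
    (fun b hb hlast => h𝒞 ⟨_, pow_sub_sigmaPoly_mem_gabidulin σ hb hlast, rfl⟩) ?_ hd hr
  · rw [hord]
    simpa using hcop
  · rw [← hF, hFt, hord, Nat.add_sub_cancel_left]

end SingleCode

section Arithmetic

theorem pow_sub_le_div {q n t : ℕ} (hq : 1 < q) (ht : 0 < t) (htn : t ≤ n) :
    q ^ (n - t) ≤ (q ^ n - 1) / (q ^ t - 1) := by
  have hqt : 1 < q ^ t := Nat.one_lt_pow ht.ne' hq
  rw [Nat.le_div_iff_mul_le (Nat.sub_pos_of_lt hqt), Nat.mul_sub, mul_one, ← pow_add,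
    Nat.sub_add_cancel htn]
  exact Nat.sub_le_sub_left (Nat.one_le_pow _ _ (by lia)) _

theorem geomSum_pred_sub_geomSum_zero_add_one (q k : ℕ) :
    geomSum q (k - 1) - geomSum q 0 + 1 = geomSum q (k - 1) := by
  refine Nat.sub_add_cancel ?_
  exact Finset.sum_le_sum_of_subset (Finset.range_subset_range.2 (by lia))

theorem geomSum_eq_add_pow {q k : ℕ} (hk : 0 < k) :
    geomSum q k = geomSum q (k - 1) + q ^ k := by
  rw [geomSum, Finset.sum_range_succ, geomSum, Nat.sub_add_cancel hk]

theorem coprime_geomSum_pow (q i k : ℕ) : (geomSum q i).Coprime (q ^ k) := by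
  refine Nat.Coprime.pow_right k ?_
  rw [geomSum, Finset.sum_range_succ', pow_zero]
  simp only [pow_succ, ← Finset.sum_mul]
  simp

end Arithmetic

end RankMetric

open RankMetric in
theorem mainTheorem7_general {ι : Type*} (t h u s n : ι → ℕ)
    (ht : ∀ i, 0 < t i) (hu : ∀ i, 0 < u i) (hhu : ∀ i, (h i + 1).Coprime (u i))
    (hn : ∀ i, n i = t i * (h i + 1 + u i)) (hsn : ∀ i, (s i).Coprime (n i))
    (K : ι → Type*) (L : ι → Type*) [∀ i, Field (K i)] [∀ i, Field (L i)]
    [∀ i, Finite (L i)] [∀ i, Algebra (K i) (L i)]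
    (N : ∀ i, IntermediateField (K i) (L i))
    (hN : ∀ i, Module.finrank (K i) (N i) = n i)
    (σ : ∀ i, L i ≃ₐ[K i] L i)
    (hσ : ∀ i x, σ i x = x ^ (Nat.card (K i) ^ s i))
    (𝒞 : ∀ i, Set (L i →ₗ[K i] L i)) (β : ∀ i, L i) (hβ : ∀ i, β i ≠ 0)
    (α : ∀ i, Fin (n i) → L i)
    (hspan : ∀ i, (Submodule.span (K i) (Set.range (α i)) : Set (L i)) =
      (fun x => β i * x) '' (N i : Set (L i)))
    (hd : ∀ i, t i * u i < minDist (K i) (evalCode (α i) (𝒞 i)))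
    (j : ι → ℕ)
    (hG : ∀ i, sigmaTwist (σ i) (j i) (gabidulin (σ i)
        (N i ⊔ IntermediateField.adjoin (K i) {β i}) (t i * h i + 1)) ⊆ 𝒞 i)
    (τ : ι → ℕ) (hτ : ∀ i, t i * u i ≤ τ i) :
    (∀ i, ∃ w : Fin (n i) → L i, w ∉ evalCode (α i) (𝒞 i) ∧
      (Nat.card (K i) ^ n i - 1) / (Nat.card (K i) ^ t i - 1) ≤
        (evalCode (α i) (𝒞 i) ∩ rankBall (K i) w (τ i)).ncard) ∧
    ((∀ B : ℕ, ∃ i, B ≤ n i) →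
      ¬ EfficientlyListDecodable K (fun i => evalCode (α i) (𝒞 i)) τ) := by
  have hlist := fun i => exists_notMem_le_ncard_inter_rankBall
    (orderOf_restrictNormalHom_eq_finrank (N i) (hσ i) (hN i ▸ hsn i)) (ht i) (hu i) (hN i) (hn i)
    (hhu i) (hβ i) (SetLike.coe_injective (hspan i)) (hd i) (hG i) (hτ i)
  have htn : ∀ i, 2 * t i ≤ n i := fun i => by
    rw [hn, mul_comm]
    exact Nat.mul_le_mul_left _ (by linarith [hu i])
  refine ⟨hlist, fun hunb => not_efficientlyListDecodable_of_pow_le_ncard one_lt_two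
    (fun i => n i - t i) (k := 2) (fun i => by have := htn i; lia) hunb fun i => ?_⟩
  obtain ⟨w, -, hw⟩ := hlist i
  have : Finite (K i) := Finite.of_injective _ (algebraMap (K i) (L i)).injective
  refine ⟨w, le_trans ?_ ((pow_sub_le_div Finite.one_lt_card (ht i) ?_).trans hw)⟩
  · exact Nat.pow_le_pow_left Finite.one_lt_card _
  · have := htn i; lia

open RankMetric in
theorem mainTheorem7 {ι : Type*}
    -- the prime `p`, the parameters `k, t, r, s`, `q' = p ^ r`, and the length `n = t p_k`
    (p k t r s q' n : ι → ℕ)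
    (hp : ∀ i, (p i).Prime) (hk : ∀ i, 0 < k i) (ht : ∀ i, 0 < t i)
    (hq' : ∀ i, q' i = p i ^ r i)
    (hn : ∀ i, n i = t i * geomSum (q' i) (k i))
    (hs : ∀ i, 0 < s i) (hsn : ∀ i, (s i).Coprime (n i))
    -- the fields `K = 𝔽_q` and `N = 𝔽_{q^n} ⊆ L = 𝔽_{q^m}`, and `σ : x ↦ x^{q^s}`
    (K : ι → Type*) (L : ι → Type*) [∀ i, Field (K i)] [∀ i, Field (L i)]
    [∀ i, Finite (L i)] [∀ i, Algebra (K i) (L i)] [∀ i, CharP (K i) (p i)]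
    (N : ∀ i, IntermediateField (K i) (L i))
    (hN : ∀ i, Module.finrank (K i) (N i) = n i)
    (σ : ∀ i, L i ≃ₐ[K i] L i)
    (hσ : ∀ i x, σ i x = x ^ (Nat.card (K i) ^ s i))
    -- the code `𝒞`, and its evaluation code over a basis `α` of `β N`
    (𝒞 : ∀ i, Set (L i →ₗ[K i] L i)) (h𝒞 : ∀ i, 𝒞 i ⊆ sigmaPolynomials (σ i))
    (β : ∀ i, L i) (hβ : ∀ i, β i ≠ 0)
    (α : ∀ i, Fin (n i) → L i) (hα : ∀ i, LinearIndependent (K i) (α i))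
    (hspan : ∀ i, (Submodule.span (K i) (Set.range (α i)) : Set (L i)) =
      (fun x => β i * x) '' (N i : Set (L i)))
    (d : ι → ℕ) (hd : ∀ i, d i = minDist (K i) (evalCode (α i) (𝒞 i)))
    (hd₁ : ∀ i, (d i - 1) / 2 + 1 ≤ t i * q' i ^ k i)
    (hd₂ : ∀ i, t i * q' i ^ k i ≤ d i - 1)
    (j : ι → ℕ) (hj : ∀ i, j i < t i * q' i ^ k i)
    -- the coefficients lie in `𝔽_{q^n}(β)`, which is `𝔽_{q^n}` when `β ∈ 𝔽_{q^n}`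
    (hG : ∀ i, sigmaTwist (σ i) (j i) (gabidulin (σ i)
        (N i ⊔ IntermediateField.adjoin (K i) {β i})
        (t i * (geomSum (q' i) (k i - 1) - geomSum (q' i) 0) + 1)) ⊆ 𝒞 i)
    (τ : ι → ℕ) (hτ : ∀ i, t i * q' i ^ k i ≤ τ i) :
    (∀ i, ∃ w : Fin (n i) → L i, w ∉ evalCode (α i) (𝒞 i) ∧
      (Nat.card (K i) ^ n i - 1) / (Nat.card (K i) ^ t i - 1) ≤
        (evalCode (α i) (𝒞 i) ∩ rankBall (K i) w (τ i)).ncard) ∧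
    ((∀ B : ℕ, ∃ i, B ≤ n i) →
      ¬ EfficientlyListDecodable K (fun i => evalCode (α i) (𝒞 i)) τ) := by
  have hq'₀ : ∀ i, 0 < q' i := fun i => hq' i ▸ pow_pos (hp i).pos _
  have hpos : ∀ i, 0 < t i * q' i ^ k i := fun i => mul_pos (ht i) (pow_pos (hq'₀ i) _)
  refine mainTheorem7_general t (fun i => geomSum (q' i) (k i - 1) - geomSum (q' i) 0)
    (fun i => q' i ^ k i) s n ht (fun i => pow_pos (hq'₀ i) _) (fun i => ?_) (fun i => ?_) hsn K L
    N hN σ hσ 𝒞 β hβ α hspan (fun i => ?_) j hG τ hτ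
  · exact geomSum_pred_sub_geomSum_zero_add_one _ _ ▸ coprime_geomSum_pow _ _ _
  · rw [hn, geomSum_pred_sub_geomSum_zero_add_one, geomSum_eq_add_pow (hk i)]
  · rw [← hd]
    exact (hd₂ i).trans_lt (Nat.pred_lt_of_lt ((hpos i).trans_le ((hd₂ i).trans (Nat.sub_le _ _))))
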